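/- Let $\partial\Delta^n\hookrightarrow\Delta^n$ denote the inclusion of the boundary of the standard $n$-simplex (with $\partial\Delta^0=\emptyset$). For a simplicial set $K$ and a vertex $x\in K_0$, let $\pi_n(K,x)$ be the set of maps $(\Delta^n,\partial\Delta^n)\to(K,x)$ modulo the equivalence relation generated by simplicial homotopy relative to $\partial\Delta^n$. A map $f\colon X\to Y$ between Kan complexes (fibrant simplicial sets) is a weak equivalence if it induces a bijection on sets of connected components $\pi_0X\to\pi_0Y$ and isomorphisms $\pi_n(X,x)\to\pi_n(Y,f(x))$ for all $n\ge 1$ and all vertices $x\in X_0$. A map $f\colon X\to Y$ of simplicial sets has the relative-homotopy-lifting property (RHLP) with respect to a map $i\colon K\to L$ if for all maps $g\colon K\to X$ and $h\colon L\to Y$ with $fg=hi$ there exist a map $l\colon L\to X$ with $li=g$ and a simplicial homotopy $H\colon L\times\Delta^1\to Y$ relative to $K$ from $fl$ to $h$, that is, $H|_{L\times\{0\}}=fl$, $H|_{L\times\{1\}}=h$, and $H\circ(i\times\mathrm{id}_{\Delta^1})$ is the composite of the projection $K\times\Delta^1\to K$ with $hi\colon K\to Y$. **Proposition 4.1.**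 A map $f\colon X\to Y$ between Kan complexes is a weak equivalence if and only if it has the RHLP with respect to the boundary inclusions $\partial\Delta^n\hookrightarrow\Delta^n$ for all $n\ge 0$. -/

import Mathlib

open CategoryTheory MonoidalCategory CartesianMonoidalCategory Simplicial

universe u

namespace SSet

/-- A commutative square `g ≫ f = i ≫ h`, where `i : K ⟶ L` is on the left and `f : X ⟶ Y` is on
the right, has a relative-homotopy-lifting: there is `l : L ⟶ X` whose restriction to `K` is `g`,
and a simplicial homotopy `H : L × Δ[1] ⟶ Y` from `l ≫ f` to `h` which is constant on `K`. -/
def HasRelHomotopyLifting {K L X Y : SSet.{u}} (i : K ⟶ L) (f : X ⟶ Y)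
    (g : K ⟶ X) (h : L ⟶ Y) : Prop :=
  ∃ l : L ⟶ X, i ≫ l = g ∧
    ∃ H : L ⊗ Δ[1] ⟶ Y, ι₀ ≫ H = l ≫ f ∧ ι₁ ≫ H = h ∧ i ▷ Δ[1] ≫ H = fst K Δ[1] ≫ i ≫ h

/-- The relative-homotopy-lifting property (RHLP) of `f : X ⟶ Y` with respect to `i : K ⟶ L`:
every commutative square from `i` to `f` has a relative-homotopy-lifting. -/
def HasRHLP {K L X Y : SSet.{u}} (i : K ⟶ L) (f : X ⟶ Y) : Prop :=
  ∀ (g : K ⟶ X) (h : L ⟶ Y), g ≫ f = i ≫ h → HasRelHomotopyLifting i f g h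

/-- `π_n(X, x)`: the maps `(Δ[n], ∂Δ[n]) ⟶ (X, x)` modulo the equivalence relation generated by
simplicial homotopy relative to `∂Δ[n]`. -/
abbrev HomotopySet (n : ℕ) (X : SSet.{u}) (x : X _⦋0⦌) : Type u :=
  RelativeMorphism.HomotopyClass (boundary n) (Subcomplex.ofSimplex x)
    (const ⟨x, Subcomplex.mem_ofSimplex_obj x⟩)

/-- The map `π_n(X, x) → π_n(Y, f x)` induced by `f : X ⟶ Y`, sending the class of `s` to the class
of `s ≫ f`. -/
def mapHomotopySet (n : ℕ) {X Y : SSet.{u}} (f : X ⟶ Y) (x : X _⦋0⦌) (c : HomotopySet n X x) :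
    HomotopySet n Y (f.app _ x) :=
  c.postcomp (RelativeMorphism.ofSimplex₀ f x (f.app _ x) rfl) rfl

/-- A map of simplicial sets (to be used between Kan complexes) is a weak equivalence if it induces
a bijection on connected components and isomorphisms on all homotopy groups `π_n`, `n ≥ 1`, for
all choices of basepoint. (The induced maps on `π_n`, `n ≥ 1`, between Kan complexes are
homomorphisms, so that they are isomorphisms if and only if they are bijective.) -/
structure IsKanWeakEquiv {X Y : SSet.{u}} (f : X ⟶ Y) : Prop where
  bijective_π₀ : Function.Bijective (mapπ₀ f)
  bijective_π : ∀ (n : ℕ), 1 ≤ n → ∀ x : X _⦋0⦌, Function.Bijective (mapHomotopySet n f x)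

end SSet

/-! ### Relative homotopies in a Kan complex -/

namespace SSet

variable {K L X Y Z : SSet.{u}}

/-! Both conditions are read as statements about homotopies of maps on `L` with prescribed
restriction to `K` (`HomotopicOver`). Relative horn filling gives homotopy extension, composition
and cancellation for these, so a lifting problem may be deformed along any homotopy of its map `K ⟶
X` (`exists_hasRelHomotopyLifting_of_homotopy`).

From weak equivalence to RHLP: for `∂Δ[0]`, use surjectivity on π₀. For `∂Δ[n + 1]`, a horn in the
boundary extends to a simplex and contracts to a vertex, so the map to `X` may be taken constant on
all faces but the one of index 0. That face is an `n`-simplex with constant boundary whose image in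
`Y` is null-homotopic, because `h` bounds it. Injectivity in degree `n` contracts it in `X`; the
boundary map becomes constant, and surjectivity on `π_(n + 1)` solves the problem.

Conversely, RHLP with constant boundary is surjectivity. For injectivity in degree `n`, a homotopy
in `Y` between the images of `s` and `t` yields a filler in `Y` for the image of the boundary with
faces `t, s, const, ...`. Lifting gives an `(n + 1)`-simplex of `X` with these faces, hence a
homotopy from `s` to `t` (`homotopicOver_δ_one_δ_zero`). -/

lemma whiskerLeft_δ_one (X : SSet.{u}) : X ◁ stdSimplex.δ (1 : Fin 2) = fst X Δ[0] ≫ ι₀ := by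
  rw [stdSimplex.δ_one_eq_const]
  rfl

lemma whiskerLeft_δ_zero (X : SSet.{u}) : X ◁ stdSimplex.δ (0 : Fin 2) = fst X Δ[0] ≫ ι₁ := by
  rw [stdSimplex.δ_zero_eq_const]
  rfl

instance epi_fst_stdSimplex_zero (X : SSet.{u}) : Epi (fst X Δ[0]) :=
  (SplitEpi.mk (lift (𝟙 X) (stdSimplex.isTerminalObj₀.from X)) (lift_fst _ _)).epi

lemma ι₀_whiskerLeft_δ_one (X : SSet.{u}) :
    (ι₀ ≫ X ◁ stdSimplex.δ (1 : Fin 3) : X ⟶ _) = ι₀ ≫ X ◁ stdSimplex.δ (2 : Fin 3) := by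
  simp only [← cancel_epi (fst X Δ[0]), ← Category.assoc, ← whiskerLeft_δ_one]
  simp only [← whiskerLeft_comp]
  exact congrArg _ (CosimplicialObject.δ_comp_δ _ (i := 1) (j := 1) le_rfl).symm

lemma ι₁_whiskerLeft_δ_one (X : SSet.{u}) :
    (ι₁ ≫ X ◁ stdSimplex.δ (1 : Fin 3) : X ⟶ _) = ι₁ ≫ X ◁ stdSimplex.δ (0 : Fin 3) := by
  simp only [← cancel_epi (fst X Δ[0]), ← Category.assoc, ← whiskerLeft_δ_zero]
  simp only [← whiskerLeft_comp]
  exact congrArg _ (CosimplicialObject.δ_comp_δ _ (i := 0) (j := 0) le_rfl)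

lemma ι₁_whiskerLeft_δ_two (X : SSet.{u}) :
    (ι₁ ≫ X ◁ stdSimplex.δ (2 : Fin 3) : X ⟶ _) = ι₀ ≫ X ◁ stdSimplex.δ (0 : Fin 3) := by
  simp only [← cancel_epi (fst X Δ[0]), ← Category.assoc, ← whiskerLeft_δ_zero,
    ← whiskerLeft_δ_one]
  simp only [← whiskerLeft_comp]
  exact congrArg _ (CosimplicialObject.δ_comp_δ _ (i := 0) (j := 1) (by simp))

open MonoidalClosed in
/-- Relative horn filling: if `i : K ⟶ L` is a monomorphism and `Y` is a Kan complex, a map on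
`L × Λ[n + 1, k]` extends to `L × Δ[n + 1]` with a prescribed restriction to `K × Δ[n + 1]`. -/
lemma exists_relative_hornFilling [KanComplex Y] (i : K ⟶ L) [Mono i] {n : ℕ} {k : Fin (n + 2)}
    (H : ∀ (j : Fin (n + 2)) (_ : j ≠ k), L ⊗ Δ[n] ⟶ Y) (T : K ⊗ Δ[n + 1] ⟶ Y)
    (hH : horn.IsCompatible (fun j hj ↦ curry (H j hj)))
    (hT : ∀ (j : Fin (n + 2)) (hj : j ≠ k), i ▷ _ ≫ H j hj = K ◁ stdSimplex.δ j ≫ T) :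
    ∃ N : L ⊗ Δ[n + 1] ⟶ Y,
      (∀ (j : Fin (n + 2)) (hj : j ≠ k), L ◁ stdSimplex.δ j ≫ N = H j hj) ∧ i ▷ _ ≫ N = T := by
  -- After currying, this is a horn lifting problem for the restriction map of internal homs from
  -- `L` to `K` into `Y`, a Kan fibration since `i` is a monomorphism.
  obtain ⟨φ, h₁, h₂⟩ := hH.exists_lift ((pre i).app Y) (curry T)
    (fun j hj ↦ by rw [curry_pre_app, hT, curry_natural_left])
  refine ⟨uncurry φ, fun j hj ↦ ?_, ?_⟩
  · rw [← uncurry_natural_left, h₁, uncurry_curry]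
  · rw [← uncurry_pre_app, h₂, uncurry_curry]

/-- The maps `u, v : L ⟶ Y` are homotopic by a homotopy whose restriction along `i : K ⟶ L`
is `G`. -/
def HomotopicOver (i : K ⟶ L) (G : K ⊗ Δ[1] ⟶ Y) (u v : L ⟶ Y) : Prop :=
  ∃ H : L ⊗ Δ[1] ⟶ Y, ι₀ ≫ H = u ∧ ι₁ ≫ H = v ∧ i ▷ _ ≫ H = G

namespace HomotopicOver

variable {i : K ⟶ L} {G : K ⊗ Δ[1] ⟶ Y} {u v w : L ⟶ Y}

lemma postcomp (h : HomotopicOver i G u v) (f : Y ⟶ Z) :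
    HomotopicOver i (G ≫ f) (u ≫ f) (v ≫ f) := by
  obtain ⟨H, h₀, h₁, h₂⟩ := h
  exact ⟨H ≫ f, by rw [← h₀, Category.assoc], by rw [← h₁, Category.assoc],
    by rw [← h₂, Category.assoc]⟩

lemma refl (i : K ⟶ L) (u : L ⟶ Y) : HomotopicOver i (fst _ _ ≫ i ≫ u) u u :=
  ⟨fst _ _ ≫ u, rfl, rfl, rfl⟩

/-- The homotopy extension property, starting from the vertex `0`. -/
lemma exists_of_ι₀ [KanComplex Y] (i : K ⟶ L) [Mono i] (G : K ⊗ Δ[1] ⟶ Y) (u : L ⟶ Y)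
    (hu : i ≫ u = ι₀ ≫ G) : ∃ v, HomotopicOver i G u v := by
  obtain ⟨N, h₁, h₂⟩ := exists_relative_hornFilling (k := (0 : Fin 2)) i
    (fun _ _ ↦ fst L Δ[0] ≫ u) G (by simp) (fun j hj ↦ by
      obtain rfl : j = 1 := by lia
      rw [whiskerLeft_δ_one, Category.assoc, ← hu, whiskerRight_fst_assoc])
  refine ⟨ι₁ ≫ N, N, ?_, rfl, h₂⟩
  rw [← cancel_epi (fst L Δ[0]), ← h₁ 1 (by simp), whiskerLeft_δ_one, Category.assoc]

/-- The homotopy extension property, starting from the vertex `1`. -/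
lemma exists_of_ι₁ [KanComplex Y] (i : K ⟶ L) [Mono i] (G : K ⊗ Δ[1] ⟶ Y) (v : L ⟶ Y)
    (hv : i ≫ v = ι₁ ≫ G) : ∃ u, HomotopicOver i G u v := by
  obtain ⟨N, h₁, h₂⟩ := exists_relative_hornFilling (k := (1 : Fin 2)) i
    (fun _ _ ↦ fst L Δ[0] ≫ v) G (by simp) (fun j hj ↦ by
      obtain rfl : j = 0 := by lia
      rw [whiskerLeft_δ_zero, Category.assoc, ← hv, whiskerRight_fst_assoc])
  refine ⟨ι₀ ≫ N, N, rfl, ?_, h₂⟩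
  rw [← cancel_epi (fst L Δ[0]), ← h₁ 0 (by simp), whiskerLeft_δ_zero, Category.assoc]

/-- Composition of homotopies lying over the spine of a map on `K × Δ[2]`. -/
lemma comp [KanComplex Y] [Mono i] (T : K ⊗ Δ[2] ⟶ Y)
    (h₀₁ : HomotopicOver i (K ◁ stdSimplex.δ 2 ≫ T) u v)
    (h₁₂ : HomotopicOver i (K ◁ stdSimplex.δ 0 ≫ T) v w) :
    HomotopicOver i (K ◁ stdSimplex.δ 1 ≫ T) u w := by
  obtain ⟨A, hA₀, hA₁, hA⟩ := h₀₁
  obtain ⟨B, hB₀, hB₁, hB⟩ := h₁₂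
  obtain ⟨N, h₁, h₂⟩ := exists_relative_hornFilling (k := (1 : Fin 3)) i
    (fun j _ ↦ if j = 0 then B else A) T (by
      rw [horn.isCompatible_iff]
      intro j k hj hk hjk
      obtain rfl : j = 0 := by lia
      obtain rfl : k = 2 := by lia
      rw [← MonoidalClosed.curry_natural_left, ← MonoidalClosed.curry_natural_left]
      congr 1
      change L ◁ stdSimplex.δ (1 : Fin 2) ≫ B = L ◁ stdSimplex.δ (0 : Fin 2) ≫ A
      rw [whiskerLeft_δ_one, whiskerLeft_δ_zero, Category.assoc, Category.assoc, hA₁, hB₀])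
    (fun j hj ↦ by fin_cases j <;> simp_all)
  have e₂ : L ◁ stdSimplex.δ 2 ≫ N = A := h₁ 2 (by simp)
  have e₀ : L ◁ stdSimplex.δ 0 ≫ N = B := h₁ 0 (by simp)
  refine ⟨L ◁ stdSimplex.δ 1 ≫ N, ?_, ?_, ?_⟩
  · rw [reassoc_of% ι₀_whiskerLeft_δ_one L, e₂, hA₀]
  · rw [reassoc_of% ι₁_whiskerLeft_δ_one L, e₀, hB₁]
  · rw [← h₂, whisker_exchange_assoc]

/-- Left cancellation of homotopies lying over the outer horn `Λ[2, 0]` of a map on `K × Δ[2]`. -/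
lemma cancel_left [KanComplex Y] [Mono i] (T : K ⊗ Δ[2] ⟶ Y)
    (h₀₁ : HomotopicOver i (K ◁ stdSimplex.δ 2 ≫ T) u v)
    (h₀₂ : HomotopicOver i (K ◁ stdSimplex.δ 1 ≫ T) u w) :
    HomotopicOver i (K ◁ stdSimplex.δ 0 ≫ T) v w := by
  obtain ⟨A, hA₀, hA₁, hA⟩ := h₀₁
  obtain ⟨B, hB₀, hB₁, hB⟩ := h₀₂
  obtain ⟨N, h₁, h₂⟩ := exists_relative_hornFilling (k := (0 : Fin 3)) i
    (fun j _ ↦ if j = 1 then B else A) T (by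
      rw [horn.isCompatible_iff]
      intro j k hj hk hjk
      obtain rfl : j = 1 := by lia
      obtain rfl : k = 2 := by lia
      rw [← MonoidalClosed.curry_natural_left, ← MonoidalClosed.curry_natural_left]
      congr 1
      change L ◁ stdSimplex.δ (1 : Fin 2) ≫ B = L ◁ stdSimplex.δ (1 : Fin 2) ≫ A
      rw [whiskerLeft_δ_one, Category.assoc, Category.assoc, hA₀, hB₀])
    (fun j hj ↦ by fin_cases j <;> simp_all)
  have e₂ : L ◁ stdSimplex.δ 2 ≫ N = A := h₁ 2 (by simp)
  have e₁ : L ◁ stdSimplex.δ 1 ≫ N = B := h₁ 1 (by simp)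
  refine ⟨L ◁ stdSimplex.δ 0 ≫ N, ?_, ?_, ?_⟩
  · rw [← reassoc_of% ι₁_whiskerLeft_δ_two L, e₂, hA₁]
  · rw [← reassoc_of% ι₁_whiskerLeft_δ_one L, e₁, hB₁]
  · rw [← h₂, whisker_exchange_assoc]

section

variable {c : K ⟶ Y}

lemma trans [KanComplex Y] [Mono i] (h₁ : HomotopicOver i (fst _ _ ≫ c) u v)
    (h₂ : HomotopicOver i (fst _ _ ≫ c) v w) : HomotopicOver i (fst _ _ ≫ c) u w :=
  comp (fst K Δ[2] ≫ c) h₁ h₂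

lemma restrict_eq (h : HomotopicOver i (fst _ _ ≫ c) u v) : i ≫ u = c := by
  obtain ⟨H, h₀, -, h₂⟩ := h
  rw [← h₀, ← ι₀_comp_assoc, h₂]
  rfl

lemma symm [KanComplex Y] [Mono i] (h : HomotopicOver i (fst _ _ ≫ c) u v) :
    HomotopicOver i (fst _ _ ≫ c) v u :=
  cancel_left (fst K Δ[2] ≫ c) h (by
    have := refl i u
    rwa [h.restrict_eq] at this)

end

/-- Composition over the degenerate triangle given by `σ 0` and `G`: its edge `δ 2` is constant and
the other two are `G`. -/
lemma const_trans [KanComplex Y] [Mono i]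
    (h₁ : HomotopicOver i (fst _ _ ≫ ι₀ ≫ G) u v) (h₂ : HomotopicOver i G v w) :
    HomotopicOver i G u w := by
  have e₀ : K ◁ stdSimplex.δ (0 : Fin 3) ≫ K ◁ stdSimplex.σ (0 : Fin 2) = 𝟙 _ := by
    rw [← whiskerLeft_comp, ← whiskerLeft_id]
    exact congrArg _ (CosimplicialObject.δ_comp_σ_self stdSimplex (i := (0 : Fin 2)))
  have e₁ : K ◁ stdSimplex.δ (1 : Fin 3) ≫ K ◁ stdSimplex.σ (0 : Fin 2) = 𝟙 _ := by
    rw [← whiskerLeft_comp, ← whiskerLeft_id]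
    exact congrArg _ (CosimplicialObject.δ_comp_σ_succ stdSimplex (i := (0 : Fin 2)))
  have e₂ : K ◁ stdSimplex.δ (2 : Fin 3) ≫ K ◁ stdSimplex.σ (0 : Fin 2) = fst _ _ ≫ ι₀ := by
    rw [← whiskerLeft_comp]
    have := CosimplicialObject.δ_comp_σ_of_gt stdSimplex.{u} (i := (1 : Fin 2)) (j := (0 : Fin 1))
      (by simp)
    refine (congrArg _ this).trans ?_
    rw [stdSimplex.δ_one_eq_const]
    rfl
  have := comp (i := i) (u := u) (v := v) (w := w) (K ◁ stdSimplex.σ (0 : Fin 2) ≫ G)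
    (by rwa [reassoc_of% e₂]) (by rwa [reassoc_of% e₀])
  rwa [reassoc_of% e₁] at this

/-- Cancellation over the degenerate triangle given by `σ 1` and `G`: its edges `δ 2` and `δ 1` are
`G`, and `δ 0` is constant. -/
lemma const_of_left [KanComplex Y] [Mono i]
    (h₁ : HomotopicOver i G u v) (h₂ : HomotopicOver i G u w) :
    HomotopicOver i (fst _ _ ≫ ι₁ ≫ G) v w := by
  have e₂ : K ◁ stdSimplex.δ (2 : Fin 3) ≫ K ◁ stdSimplex.σ (1 : Fin 2) = 𝟙 _ := by
    rw [← whiskerLeft_comp, ← whiskerLeft_id]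
    exact congrArg _ (CosimplicialObject.δ_comp_σ_succ stdSimplex (i := (1 : Fin 2)))
  have e₁ : K ◁ stdSimplex.δ (1 : Fin 3) ≫ K ◁ stdSimplex.σ (1 : Fin 2) = 𝟙 _ := by
    rw [← whiskerLeft_comp, ← whiskerLeft_id]
    exact congrArg _ (CosimplicialObject.δ_comp_σ_self stdSimplex (i := (1 : Fin 2)))
  have e₀ : K ◁ stdSimplex.δ (0 : Fin 3) ≫ K ◁ stdSimplex.σ (1 : Fin 2) = fst _ _ ≫ ι₁ := by
    rw [← whiskerLeft_comp]
    have := CosimplicialObject.δ_comp_σ_of_le stdSimplex.{u} (i := (0 : Fin 2)) (j := (0 : Fin 1))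
      (by simp)
    refine (congrArg _ this).trans ?_
    rw [stdSimplex.δ_zero_eq_const]
    rfl
  have := cancel_left (i := i) (u := u) (v := v) (w := w) (K ◁ stdSimplex.σ (1 : Fin 2) ≫ G)
    (by rwa [reassoc_of% e₂]) (by rwa [reassoc_of% e₁])
  rwa [reassoc_of% e₀] at this

end HomotopicOver

/-- Relative homotopy lifting is invariant under a homotopy `G` of the map `K ⟶ X`. -/
lemma exists_hasRelHomotopyLifting_of_homotopy [KanComplex X] [KanComplex Y] (i : K ⟶ L) [Mono i]
    (f : X ⟶ Y) (G : K ⊗ Δ[1] ⟶ X) (h : L ⟶ Y) (w : (ι₁ ≫ G) ≫ f = i ≫ h) :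
    ∃ h' : L ⟶ Y, (ι₀ ≫ G) ≫ f = i ≫ h' ∧
      (HasRelHomotopyLifting i f (ι₀ ≫ G) h' → HasRelHomotopyLifting i f (ι₁ ≫ G) h) := by
  obtain ⟨h', hh⟩ := HomotopicOver.exists_of_ι₁ i (G ≫ f) h (by rw [← w, Category.assoc])
  have w' : (ι₀ ≫ G) ≫ f = i ≫ h' := by
    obtain ⟨H, h₀, -, h₂⟩ := hh
    rw [← h₀, ← ι₀_comp_assoc, h₂, Category.assoc]
  refine ⟨h', w', ?_⟩
  rintro ⟨l', hl', H'⟩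
  obtain ⟨l, hl⟩ := HomotopicOver.exists_of_ι₀ i G l' hl'
  refine ⟨l, ?_, ?_⟩
  · obtain ⟨H, -, h₁, h₂⟩ := hl
    rw [← h₁, ← ι₁_comp_assoc, h₂]
  · have h₁ : HomotopicOver i (fst _ _ ≫ i ≫ h') (l' ≫ f) h' := H'
    rw [← w', Category.assoc] at h₁
    -- Two homotopies over `G ≫ f` start at `l' ≫ f`, one ending at `l ≫ f` and the other at `h`;
    -- cancelling leaves one that is constant on `K`.
    have := (hl.postcomp f).const_of_left (h₁.const_trans hh)
    rwa [← Category.assoc ι₁, w] at this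

end SSet

/-! ### Gluing maps along the faces of a boundary -/

namespace SSet

variable {X Y Z : SSet.{u}} {n : ℕ}

namespace boundary

/-- The boundary of a simplex is the multicoequalizer of its codimension `1` faces, glued along
the codimension `2` faces. -/
lemma multicoequalizerDiagram (n : ℕ) :
    Subcomplex.MulticoequalizerDiagram ∂Δ[n]
      (fun (j : Fin (n + 1)) ↦ stdSimplex.face.{u} {j}ᶜ)
      (fun j k ↦ stdSimplex.face {j, k}ᶜ) where
  iSup_eq := by rw [boundary_eq_iSup]
  eq_inf j k := by
    rw [stdSimplex.face_inter_face]
    congr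
    aesop

/-- Maps `Δ[n] ⟶ X` which are constant with the same value on the boundary are the faces of
a map `∂Δ[n + 1] ⟶ X`. -/
lemma exists_desc_of_const (x : X _⦋0⦌) (f : Fin (n + 2) → (Δ[n] ⟶ X))
    (hf : ∀ j, ∂Δ[n].ι ≫ f j = const x) :
    ∃ (φ : (∂Δ[n + 1] : SSet) ⟶ X), ∀ j, boundary.ι j ≫ φ = f j := by
  let c : Limits.Multicofork
      ((multicoequalizerDiagram.{u} (n + 1)).multispanIndex.toLinearOrder.map
        Subcomplex.toSSetFunctor) :=
    Limits.Multicofork.ofπ _ X (fun j ↦ (stdSimplex.faceSingletonComplIso j).inv ≫ f j) (by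
      rintro ⟨⟨a, b⟩, hab : a < b⟩
      dsimp
      -- For `n = 0` the two faces of `Δ[1]` are disjoint. Otherwise both restrictions to a
      -- codimension 2 face factor through `∂Δ[n]`, where each `f j` is `const x`.
      obtain _ | n := n
      · obtain rfl : a = 0 := by lia
        obtain rfl : b = 1 := by lia
        ext ⟨m⟩ ⟨x, hx⟩
        have := hx (Finset.mem_image_of_mem _ (Finset.mem_univ 0))
        simp only [Finset.mem_compl, Finset.mem_insert, Finset.mem_singleton] at this
        lia
      · have ha : stdSimplex.face.{u} {a, b}ᶜ ≤ stdSimplex.face {a}ᶜ := by simp [stdSimplex.face_le_face_iff]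
        have hb : stdSimplex.face.{u} {a, b}ᶜ ≤ stdSimplex.face {b}ᶜ := by simp [stdSimplex.face_le_face_iff]
        change Subcomplex.homOfLE ha ≫ (stdSimplex.faceSingletonComplIso a).inv ≫ f a =
          Subcomplex.homOfLE hb ≫ (stdSimplex.faceSingletonComplIso b).inv ≫ f b
        rw [stdSimplex.homOfLE_faceSingletonComplIso_inv_eq_facePairComplIso_inv_δ_pred_assoc
            _ _ hab,
          stdSimplex.homOfLE_faceSingletonComplIso_inv_eq_facePairComplIso_inv_δ_castPred_assoc
            _ _ hab]
        congr 1
        rw [← boundary.ι_ι, ← boundary.ι_ι, Category.assoc, Category.assoc, hf, hf]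
        rfl)
  refine ⟨(multicoequalizerDiagram.{u} (n + 1)).isColimit'.desc c, fun j ↦ ?_⟩
  rw [← cancel_epi (stdSimplex.faceSingletonComplIso j).inv]
  refine Eq.trans ?_ ((multicoequalizerDiagram.{u} (n + 1)).isColimit'.fac c (.right j))
  exact faceSingletonComplIso_inv_ι_assoc j _

open MonoidalClosed in
/-- A version of `boundary.exists_desc_of_const` with parameters. -/
lemma exists_desc_whiskerRight_of_const (x : X _⦋0⦌) (f : Fin (n + 2) → (Δ[n] ⊗ Z ⟶ X))
    (hf : ∀ j, ∂Δ[n].ι ▷ Z ≫ f j = const x) :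
    ∃ (φ : (∂Δ[n + 1] : SSet) ⊗ Z ⟶ X), ∀ j, boundary.ι j ▷ Z ≫ φ = f j := by
  -- The base point is the constant map `Z ⟶ X`, seen as a vertex of the internal hom.
  obtain ⟨φ, hφ⟩ := exists_desc_of_const (n := n)
    (yonedaEquiv (curry (const x : Z ⊗ Δ[0] ⟶ X))) (fun j ↦ curry ((β_ _ _).hom ≫ f j))
    (fun j ↦ by
      rw [← curry_natural_left, BraidedCategory.braiding_naturality_right_assoc, hf, comp_const]
      have : (const (yonedaEquiv (curry (const x : Z ⊗ Δ[0] ⟶ X))) : (∂Δ[n] : SSet) ⟶ _) =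
          const (stdSimplex.obj₀Equiv.symm 0) ≫ curry (const x : Z ⊗ Δ[0] ⟶ X) := by
        rw [const_comp]
        rfl
      rw [this, ← curry_natural_left, comp_const])
  refine ⟨(β_ _ _).hom ≫ uncurry φ, fun j ↦ ?_⟩
  rw [BraidedCategory.braiding_naturality_left_assoc, ← uncurry_natural_left, hφ, uncurry_curry,
    SymmetricCategory.symmetry_assoc]

open MonoidalClosed in
lemma whiskerRight_hom_ext {f g : (∂Δ[n + 1] : SSet.{u}) ⊗ Z ⟶ X}
    (h : ∀ j, boundary.ι j ▷ Z ≫ f = boundary.ι j ▷ Z ≫ g) : f = g := by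
  rw [← cancel_epi (β_ _ _).hom]
  refine curry_injective (boundary.hom_ext (fun j ↦ ?_))
  rw [← curry_natural_left, ← curry_natural_left,
    BraidedCategory.braiding_naturality_right_assoc,
    BraidedCategory.braiding_naturality_right_assoc, h]

lemma whiskerRight_hom_ext₀ {f g : (∂Δ[0] : SSet.{u}) ⊗ Z ⟶ X} : f = g := by
  rw [← cancel_epi (β_ _ _).hom]
  exact MonoidalClosed.curry_injective boundary.hom_ext₀

end boundary

/-! ### Explicit homotopies between maps of simplices -/

namespace prodStdSimplex

/-- The map `Δ[p] ⊗ Δ[q] ⟶ Δ[r]` given by a monotone map on vertices. -/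
@[simps]
def homMk {p q r : ℕ} (φ : Fin (p + 1) × Fin (q + 1) →o Fin (r + 1)) :
    (Δ[p] ⊗ Δ[q] : SSet.{u}) ⟶ Δ[r] where
  app m := TypeCat.ofHom (fun x ↦ stdSimplex.objMk (φ.comp (objEquiv (n := m.unop.len) x)))
  naturality _ _ _ := rfl

/-- The contraction of `Δ[n]` to the vertex `0`, as a map on vertices. -/
def contractionOrderHom (n : ℕ) : Fin (n + 1) × Fin 2 →o Fin (n + 1) where
  toFun x := if x.2 = 0 then 0 else x.1
  monotone' := by
    rintro ⟨a, s⟩ ⟨b, t⟩ ⟨hab, hst⟩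
    dsimp at hab hst ⊢
    split_ifs <;> lia

lemma contractionOrderHom_apply (n : ℕ) (a : Fin (n + 1)) (b : Fin 2) :
    contractionOrderHom n (a, b) = if b = 0 then 0 else a := rfl

/-- The homotopy on `Δ[n]` from the constant map at the vertex `0` to the identity. -/
abbrev contraction (n : ℕ) : Δ[n] ⊗ Δ[1] ⟶ (Δ[n] : SSet.{u}) := homMk (contractionOrderHom n)

/-- The homotopy from `δ 1` to `δ 0`, as a map on vertices. -/
def faceHomotopyOrderHom (n : ℕ) : Fin (n + 1) × Fin 2 →o Fin (n + 2) where
  toFun x := if x.1 = 0 then (if x.2 = 0 then 0 else 1) else x.1.succ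
  monotone' := by
    rintro ⟨a, s⟩ ⟨b, t⟩ ⟨hab, hst⟩
    dsimp at hab hst ⊢
    split_ifs <;> simp only [Fin.le_def, Fin.val_succ, Fin.val_zero, Fin.val_one] <;> lia

lemma faceHomotopyOrderHom_apply (n : ℕ) (a : Fin (n + 1)) (b : Fin 2) :
    faceHomotopyOrderHom n (a, b) =
      if a = 0 then (if b = 0 then 0 else 1) else a.succ := rfl

/-- The homotopy from `δ 1` to `δ 0 : Δ[n] ⟶ Δ[n + 1]`. -/
abbrev faceHomotopy (n : ℕ) : Δ[n] ⊗ Δ[1] ⟶ (Δ[n + 1] : SSet.{u}) :=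
  homMk (faceHomotopyOrderHom n)

lemma ι₀_contraction :
    ι₀ ≫ contraction.{u} n = const (stdSimplex.obj₀Equiv.symm 0) := by
  ext ⟨m⟩ x
  induction m using SimplexCategory.rec
  ext j
  rfl

lemma ι₁_contraction : ι₁ ≫ contraction.{u} n = 𝟙 _ := by
  ext ⟨m⟩ x
  induction m using SimplexCategory.rec
  ext j
  rfl

/-- A face opposite a nonzero vertex contains the vertex 0, so the contraction preserves it. -/
lemma δ_succ_contraction (j : Fin (n + 1)) :
    stdSimplex.δ j.succ ▷ _ ≫ contraction.{u} (n + 1) = contraction n ≫ stdSimplex.δ j.succ := by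
  have key (a : Fin (n + 1)) (b : Fin 2) :
      contractionOrderHom (n + 1) (j.succ.succAbove a, b) =
        j.succ.succAbove (contractionOrderHom n (a, b)) := by
    simp only [contractionOrderHom_apply]
    split_ifs <;> simp
  ext ⟨m⟩ ⟨x, t⟩
  induction m using SimplexCategory.rec
  refine stdSimplex.ext _ _ fun k ↦ ?_
  exact key _ _

lemma ι₀_faceHomotopy : ι₀ ≫ faceHomotopy.{u} n = stdSimplex.δ 1 := by
  have key (a : Fin (n + 1)) :
      faceHomotopyOrderHom n (a, 0) = Fin.succAbove 1 a := by
    simp only [faceHomotopyOrderHom_apply]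
    obtain rfl | ha := eq_or_ne a 0
    · simp
    · rw [if_neg ha, Fin.succAbove_of_le_castSucc _ _ (by simp [Fin.le_def]; lia)]
  ext ⟨m⟩ x
  induction m using SimplexCategory.rec
  refine stdSimplex.ext _ _ fun k ↦ ?_
  exact key _

lemma ι₁_faceHomotopy : ι₁ ≫ faceHomotopy.{u} n = stdSimplex.δ 0 := by
  have key (a : Fin (n + 1)) :
      faceHomotopyOrderHom n (a, 1) = Fin.succAbove 0 a := by
    simp only [faceHomotopyOrderHom_apply]
    obtain rfl | ha := eq_or_ne a 0
    · simp
    · simp [ha]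
  ext ⟨m⟩ x
  induction m using SimplexCategory.rec
  refine stdSimplex.ext _ _ fun k ↦ ?_
  exact key _

/-- Only the vertex 0 moves, so the homotopy is stationary on the face opposite to it. -/
lemma δ_zero_faceHomotopy :
    stdSimplex.δ 0 ▷ _ ≫ faceHomotopy.{u} (n + 1) =
      fst _ _ ≫ stdSimplex.δ 0 ≫ stdSimplex.δ 0 := by
  have key (a : Fin (n + 1)) (b : Fin 2) :
      faceHomotopyOrderHom (n + 1) (Fin.succAbove 0 a, b) =
        Fin.succAbove 0 (Fin.succAbove 0 a) := by
    simp [faceHomotopyOrderHom_apply]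
  ext ⟨m⟩ ⟨x, t⟩
  induction m using SimplexCategory.rec
  refine stdSimplex.ext _ _ fun k ↦ ?_
  exact key _ (t k)

lemma δ_succ_faceHomotopy (j : Fin (n + 1)) :
    stdSimplex.δ j.succ ▷ _ ≫ faceHomotopy.{u} (n + 1) =
      faceHomotopy n ≫ stdSimplex.δ j.succ.succ := by
  have key (a : Fin (n + 1)) (b : Fin 2) :
      faceHomotopyOrderHom (n + 1) (j.succ.succAbove a, b) =
        j.succ.succ.succAbove (faceHomotopyOrderHom n (a, b)) := by
    simp only [faceHomotopyOrderHom_apply]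
    obtain rfl | ha := eq_or_ne a 0
    · obtain rfl | hb := eq_or_ne b 0
      · simp
      · simp [hb]
    · rw [if_neg ha, if_neg (Fin.succAbove_ne_zero (Fin.succ_ne_zero _) ha),
        Fin.succ_succAbove_succ]
  ext ⟨m⟩ ⟨x, t⟩
  induction m using SimplexCategory.rec
  refine stdSimplex.ext _ _ fun k ↦ ?_
  exact key _ _

end prodStdSimplex

end SSet

/-! ### Connected components and homotopy sets through relative homotopies -/

namespace SSet

variable {X Y : SSet.{u}} {n : ℕ}

lemma ι₀_eq_δ_one_comp :
    (ι₀ : Δ[0] ⟶ Δ[0] ⊗ Δ[1]) =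
      stdSimplex.{u}.δ 1 ≫ lift (stdSimplex.isTerminalObj₀.from _) (𝟙 _) := by
  ext : 1
  · exact stdSimplex.ext₀
  · rw [ι₀_snd, Category.assoc, lift_snd, Category.comp_id, stdSimplex.δ_one_eq_const]

lemma ι₁_eq_δ_zero_comp :
    (ι₁ : Δ[0] ⟶ Δ[0] ⊗ Δ[1]) =
      stdSimplex.{u}.δ 0 ≫ lift (stdSimplex.isTerminalObj₀.from _) (𝟙 _) := by
  ext : 1
  · exact stdSimplex.ext₀
  · rw [ι₁_snd, Category.assoc, lift_snd, Category.comp_id, stdSimplex.δ_zero_eq_const]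

/-- In a Kan complex, two vertices are in the same connected component if and only if they are
homotopic as maps from `Δ[0]`. -/
lemma π₀_mk_eq_iff [KanComplex Y] (a b : Δ[0] ⟶ Y) (G : (∂Δ[0] : SSet) ⊗ Δ[1] ⟶ Y) :
    π₀.mk (yonedaEquiv a) = π₀.mk (yonedaEquiv b) ↔ HomotopicOver ∂Δ[0].ι G a b := by
  -- As `∂Δ[0]` is empty, `G` can be exchanged for the constant homotopy that `symm` and `trans`
  -- require.
  have hG (G' : (∂Δ[0] : SSet) ⊗ Δ[1] ⟶ Y) : G = G' := boundary.whiskerRight_hom_ext₀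
  constructor
  · rw [π₀.mk_eq_mk_iff]
    obtain ⟨a, rfl⟩ := yonedaEquiv.symm.surjective a
    obtain ⟨b, rfl⟩ := yonedaEquiv.symm.surjective b
    simp only [Equiv.apply_symm_apply]
    intro h
    induction h with
    | rel a b h =>
      obtain ⟨e⟩ := h
      refine ⟨snd _ _ ≫ yonedaEquiv.symm e.edge, ?_, ?_, boundary.whiskerRight_hom_ext₀⟩
      · rw [ι₀_snd_assoc, ← stdSimplex.δ_one_eq_const, stdSimplex.δ_comp_yonedaEquiv_symm,
          e.src_eq]
      · rw [ι₁_snd_assoc, ← stdSimplex.δ_zero_eq_const, stdSimplex.δ_comp_yonedaEquiv_symm,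
          e.tgt_eq]
    | refl a => rw [hG]; exact .refl _ _
    | symm a b _ h =>
      rw [hG (fst _ _ ≫ ∂Δ[0].ι ≫ yonedaEquiv.symm a)] at h ⊢
      exact h.symm
    | trans a b c _ _ h₁ h₂ =>
      rw [hG (fst _ _ ≫ ∂Δ[0].ι ≫ yonedaEquiv.symm a)] at h₁ h₂ ⊢
      exact h₁.trans h₂
  · rintro ⟨H, rfl, rfl, -⟩
    rw [ι₀_eq_δ_one_comp, ι₁_eq_δ_zero_comp, Category.assoc, Category.assoc,
      stdSimplex.yonedaEquiv_δ_comp, stdSimplex.yonedaEquiv_δ_comp]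
    exact π₀.sound (Edge.mk' _)

namespace PtSimplex

variable {x : X _⦋0⦌}

lemma boundary_ι_map (s : X.PtSimplex n x) : ∂Δ[n].ι ≫ s.map = SSet.const x := by
  rw [s.comm]
  rfl

/-- Constructor for pointed simplices. -/
@[simps]
def ofMap (s : Δ[n] ⟶ X) (hs : ∂Δ[n].ι ≫ s = SSet.const x) : X.PtSimplex n x where
  map := s
  comm := hs

/-- The image of a pointed simplex by a morphism. -/
abbrev postcomp (s : X.PtSimplex n x) (f : X ⟶ Y) : Y.PtSimplex n (f.app _ x) :=
  s.comp (RelativeMorphism.ofSimplex₀ f x (f.app _ x) rfl) rfl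

lemma homotopyClass_eq_iff [KanComplex X] (s t : X.PtSimplex n x) :
    s.homotopyClass = t.homotopyClass ↔
      HomotopicOver ∂Δ[n].ι (SSet.const x) s.map t.map := by
  constructor
  · intro h
    have h' := Quot.eq.1 h
    clear h
    induction h' with
    | rel s t h =>
      obtain ⟨h⟩ := h
      exact ⟨h.h, h.h₀, h.h₁, h.rel⟩
    | refl s =>
      have := HomotopicOver.refl ∂Δ[n].ι s.map
      rwa [boundary_ι_map] at this
    | symm s t _ h => exact HomotopicOver.symm (c := SSet.const x) h
    | trans s t u _ _ h₁ h₂ => exact HomotopicOver.trans (c := SSet.const x) h₁ h₂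
  · rintro ⟨H, h₀, h₁, h₂⟩
    exact RelativeMorphism.Homotopy.eq { h := H, h₀ := h₀, h₁ := h₁, rel := h₂ }

end PtSimplex

/-- A map reflects homotopies between simplices with constant boundary. -/
def ReflectsPtHomotopy (f : X ⟶ Y) (n : ℕ) : Prop :=
  ∀ (x : X _⦋0⦌) (s t : X.PtSimplex n x),
    HomotopicOver ∂Δ[n].ι (const (f.app _ x)) (s.map ≫ f) (t.map ≫ f) →
      HomotopicOver ∂Δ[n].ι (const x) s.map t.map

variable {f : X ⟶ Y}

/-- Puts π₀ on the same footing as the higher `π_n`: the boundary of `Δ[0]` is empty, so the base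
point plays no role. -/
lemma injective_mapπ₀_iff [KanComplex X] [KanComplex Y] :
    Function.Injective (mapπ₀ f) ↔ ReflectsPtHomotopy f 0 := by
  constructor
  · intro hf x s t h
    rw [← π₀_mk_eq_iff] at h ⊢
    exact hf h
  · intro hf a b h
    induction a with | mk a
    induction b with | mk b
    obtain ⟨a, rfl⟩ := yonedaEquiv.surjective a
    obtain ⟨b, rfl⟩ := yonedaEquiv.surjective b
    let x := yonedaEquiv a
    have h' : π₀.mk (yonedaEquiv (a ≫ f)) = π₀.mk (yonedaEquiv (b ≫ f)) := h
    rw [π₀_mk_eq_iff _ _ (const (f.app _ x))] at h'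
    exact (π₀_mk_eq_iff _ _ (const x)).2
      (hf x (.ofMap a boundary.hom_ext₀) (.ofMap b boundary.hom_ext₀) h')

lemma injective_mapHomotopySet_iff [KanComplex X] [KanComplex Y] (n : ℕ) :
    (∀ x, Function.Injective (mapHomotopySet n f x)) ↔ ReflectsPtHomotopy f n := by
  refine forall_congr' fun x ↦ ⟨fun hf s t h ↦ ?_, fun hf a b h ↦ ?_⟩
  · rw [← PtSimplex.homotopyClass_eq_iff]
    exact hf ((PtSimplex.homotopyClass_eq_iff (PtSimplex.postcomp s f) (PtSimplex.postcomp t f)).2 h)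
  · obtain ⟨s, rfl⟩ := a.eq_homotopyClass
    obtain ⟨t, rfl⟩ := b.eq_homotopyClass
    rw [PtSimplex.homotopyClass_eq_iff]
    exact hf s t ((PtSimplex.homotopyClass_eq_iff (PtSimplex.postcomp s f) (PtSimplex.postcomp t f)).1 h)

lemma surjective_mapHomotopySet_iff [KanComplex Y] (n : ℕ) (x : X _⦋0⦌) :
    Function.Surjective (mapHomotopySet n f x) ↔ ∀ t : Y.PtSimplex n (f.app _ x),
      ∃ s : X.PtSimplex n x,
        HomotopicOver ∂Δ[n].ι (const (f.app _ x)) (s.map ≫ f) t.map := by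
  constructor
  · intro hf t
    obtain ⟨c, hc⟩ := hf t.homotopyClass
    obtain ⟨s, rfl⟩ := c.eq_homotopyClass
    exact ⟨s, (PtSimplex.homotopyClass_eq_iff (PtSimplex.postcomp s f) t).1 hc⟩
  · intro hf c
    obtain ⟨t, rfl⟩ := c.eq_homotopyClass
    obtain ⟨s, hs⟩ := hf t
    exact ⟨s.homotopyClass, (PtSimplex.homotopyClass_eq_iff (PtSimplex.postcomp s f) t).2 hs⟩

end SSet

/-! ### From homotopy sets to the RHLP and back -/

namespace SSet

variable {X Y : SSet.{u}} {f : X ⟶ Y} {n : ℕ}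

/-- The inclusion of a horn in the boundary. -/
def horn.toBoundary (n : ℕ) (i : Fin (n + 2)) :
    (Λ[n + 1, i] : SSet.{u}) ⟶ ∂Δ[n + 1] :=
  Subcomplex.homOfLE (by
    rw [horn_eq_iSup, iSup_le_iff]
    exact fun j ↦ face_singleton_compl_le_boundary _)

lemma horn.ι_toBoundary (i j : Fin (n + 2)) (hj : j ≠ i) :
    horn.ι.{u} i j hj ≫ horn.toBoundary n i = boundary.ι j := rfl

instance (i : Fin (n + 2)) : Mono (horn.toBoundary.{u} n i) := by
  dsimp [horn.toBoundary]
  infer_instance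

/-- Faces of the face of index `0`. -/
lemma boundary.δ_comp_ι_zero (j : Fin (n + 2)) :
    stdSimplex.δ j ≫ boundary.ι.{u} (0 : Fin (n + 3)) = stdSimplex.δ 0 ≫ boundary.ι j.succ := by
  rw [← cancel_mono (Subcomplex.ι _), Category.assoc, Category.assoc, boundary.ι_ι,
    boundary.ι_ι]
  exact (CosimplicialObject.δ_comp_δ stdSimplex (i := 0) (j := j) (Fin.zero_le _)).symm

/-- If all the faces of a map `∂Δ[n + 1] ⟶ X` but the face of index `0` are constant, then the
face of index `0` is constant on its boundary. -/
lemma boundary.ι_zero_comp_eq_const {x : X _⦋0⦌} (g : (∂Δ[n + 1] : SSet) ⟶ X)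
    (hg : ∀ j : Fin (n + 1), boundary.ι j.succ ≫ g = const x) :
    ∂Δ[n].ι ≫ boundary.ι 0 ≫ g = const x := by
  obtain _ | n := n
  · exact boundary.hom_ext₀
  · refine boundary.hom_ext fun j ↦ ?_
    rw [boundary.ι_ι_assoc, ← Category.assoc, boundary.δ_comp_ι_zero, Category.assoc, hg]
    rfl

/-- Any map from the boundary of a simplex to a Kan complex is homotopic to a map which is
constant on the faces of nonzero index. -/
lemma exists_homotopy_of_boundary [KanComplex X] (g : (∂Δ[n + 1] : SSet) ⟶ X) :
    ∃ (x : X _⦋0⦌) (G : (∂Δ[n + 1] : SSet) ⊗ Δ[1] ⟶ X), ι₁ ≫ G = g ∧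
      ∀ j : Fin (n + 1), boundary.ι j.succ ≫ ι₀ ≫ G = const x := by
  obtain ⟨κ, hκ⟩ := KanComplex.hornFilling (horn.toBoundary n 0 ≫ g)
  -- The contraction, followed by `κ`, is restricted to the horn and then extended to the boundary;
  -- only the face of index 0 is left uncontrolled.
  let C := prodStdSimplex.contraction.{u} (n + 1)
  obtain ⟨g', G, h₀, h₁, h₂⟩ := HomotopicOver.exists_of_ι₁ (horn.toBoundary n 0)
    (Λ[n + 1, 0].ι ▷ _ ≫ C ≫ κ) g (by
      rw [ι₁_comp_assoc, reassoc_of% prodStdSimplex.ι₁_contraction, hκ])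
  refine ⟨κ.app _ (stdSimplex.obj₀Equiv.symm 0), G, h₁, fun j ↦ ?_⟩
  rw [← horn.ι_toBoundary 0 j.succ (Fin.succ_ne_zero j), Category.assoc, ← ι₀_comp_assoc, h₂,
    ι₀_comp_assoc, reassoc_of% prodStdSimplex.ι₀_contraction, const_comp]
  rfl

/-- If all the faces of `h : Δ[n + 1] ⟶ Y` but the face of index `0` are constant, then this
face is homotopic to a constant map. -/
lemma homotopicOver_const_δ_zero {y : Y _⦋0⦌} (h : Δ[n + 1] ⟶ Y)
    (hh : ∀ j : Fin (n + 1), stdSimplex.δ j.succ ≫ h = const y) :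
    HomotopicOver ∂Δ[n].ι (const y) (const y) (stdSimplex.δ 0 ≫ h) := by
  -- The contraction is restricted to the face of index 0. The boundary of this face lies in the
  -- faces of nonzero index, which are preserved and on which `h` is constant.
  refine ⟨stdSimplex.δ 0 ▷ _ ≫ prodStdSimplex.contraction (n + 1) ≫ h, ?_, ?_, ?_⟩
  · have hv : (const (stdSimplex.obj₀Equiv.symm 0) : Δ[n] ⟶ Δ[n + 1]) =
        const (stdSimplex.obj₀Equiv.symm 0) ≫ stdSimplex.δ (Fin.succ (0 : Fin (n + 1))) := by
      rw [const_comp]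
      congr 1
    rw [ι₀_comp_assoc, reassoc_of% prodStdSimplex.ι₀_contraction, ← Category.assoc, comp_const, hv,
      Category.assoc, hh, comp_const]
  · rw [ι₁_comp_assoc, reassoc_of% prodStdSimplex.ι₁_contraction]
  · obtain _ | n := n
    · exact boundary.whiskerRight_hom_ext₀
    · refine boundary.whiskerRight_hom_ext fun j ↦ ?_
      rw [← comp_whiskerRight_assoc, boundary.ι_ι, ← comp_whiskerRight_assoc]
      have := CosimplicialObject.δ_comp_δ stdSimplex.{u} (i := 0) (j := j) (Fin.zero_le _)
      rw [Fin.castSucc_zero] at this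
      rw [← this, comp_whiskerRight_assoc,
        reassoc_of% prodStdSimplex.δ_succ_contraction j, hh]
      rfl

/-- If the faces of index `≥ 2` of `l : Δ[n + 1] ⟶ X` are constant, then the faces of index
`1` and `0` are homotopic. -/
lemma homotopicOver_δ_one_δ_zero {x : X _⦋0⦌} (l : Δ[n + 1] ⟶ X)
    (h₀ : ∂Δ[n].ι ≫ stdSimplex.δ 0 ≫ l = const x)
    (hl : ∀ j : Fin n, stdSimplex.δ j.succ.succ ≫ l = const x) :
    HomotopicOver ∂Δ[n].ι (const x) (stdSimplex.δ 1 ≫ l) (stdSimplex.δ 0 ≫ l) := by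
  refine ⟨prodStdSimplex.faceHomotopy n ≫ l, ?_, ?_, ?_⟩
  · rw [reassoc_of% prodStdSimplex.ι₀_faceHomotopy]
  · rw [reassoc_of% prodStdSimplex.ι₁_faceHomotopy]
  · obtain _ | n := n
    · exact boundary.whiskerRight_hom_ext₀
    · refine boundary.whiskerRight_hom_ext fun j ↦ ?_
      rw [← comp_whiskerRight_assoc, boundary.ι_ι]
      obtain rfl | ⟨j, rfl⟩ := j.eq_zero_or_eq_succ
      · rw [reassoc_of% prodStdSimplex.δ_zero_faceHomotopy, ← boundary.ι_ι, Category.assoc, h₀]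
        rfl
      · rw [reassoc_of% prodStdSimplex.δ_succ_faceHomotopy j, hl]
        rfl

/-- A map between Kan complexes has the RHLP with respect to `∂Δ[n + 1]` if it reflects homotopies
of `n`-simplices with constant boundary and is surjective on `π_(n + 1)`. -/
lemma hasRHLP_boundary_succ [KanComplex X] [KanComplex Y] (hf : ReflectsPtHomotopy f n)
    (hf' : ∀ x, Function.Surjective (mapHomotopySet (n + 1) f x)) :
    HasRHLP ∂Δ[n + 1].ι f := by
  intro g h w
  obtain ⟨x, G, rfl, hG⟩ := exists_homotopy_of_boundary g
  obtain ⟨h₁, w₁, H₁⟩ := exists_hasRelHomotopyLifting_of_homotopy ∂Δ[n + 1].ι f G h w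
  refine H₁ ?_
  generalize ι₀ ≫ G = g₁ at *
  let a : X.PtSimplex n x := .ofMap (boundary.ι 0 ≫ g₁) (boundary.ι_zero_comp_eq_const g₁ hG)
  -- In `Y` the face `a` becomes the face of index 0 of `h₁`, whose other faces are constant; it is
  -- therefore null-homotopic there, hence also in `X`.
  obtain ⟨A, hA₀, hA₁, hA⟩ := hf x RelativeMorphism.const a (by
    have := homotopicOver_const_δ_zero (y := f.app _ x) h₁ (fun j ↦ by
      rw [← boundary.ι_ι, Category.assoc, ← w₁, reassoc_of% hG, const_comp])
    rw [← boundary.ι_ι, Category.assoc, ← w₁] at this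
    simpa [a] using this)
  -- Gluing `A` with constant homotopies on the other faces deforms `g₁` to a constant map.
  obtain ⟨G₁, hG₁⟩ := boundary.exists_desc_whiskerRight_of_const x
    (Fin.cons A (fun _ ↦ const x) : Fin (n + 2) → (Δ[n] ⊗ Δ[1] ⟶ X)) (fun j ↦ by
      obtain rfl | ⟨j, rfl⟩ := j.eq_zero_or_eq_succ
      · exact hA
      · rfl)
  have e₁ : ι₁ ≫ G₁ = g₁ := boundary.hom_ext fun j ↦ by
    rw [← ι₁_comp_assoc, hG₁]
    obtain rfl | ⟨j, rfl⟩ := j.eq_zero_or_eq_succ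
    · exact hA₁
    · exact (hG j).symm
  have e₀ : ι₀ ≫ G₁ = const x := boundary.hom_ext fun j ↦ by
    rw [← ι₀_comp_assoc, hG₁]
    obtain rfl | ⟨j, rfl⟩ := j.eq_zero_or_eq_succ
    · exact hA₀
    · rfl
  subst e₁
  obtain ⟨h₂, w₂, H₂⟩ := exists_hasRelHomotopyLifting_of_homotopy ∂Δ[n + 1].ι f G₁ h₁ w₁
  refine H₂ ?_
  rw [e₀] at w₂ ⊢
  rw [const_comp] at w₂
  obtain ⟨s, hs⟩ := (surjective_mapHomotopySet_iff _ _).1 (hf' x) (.ofMap h₂ w₂.symm)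
  refine ⟨s.map, s.boundary_ι_map, ?_⟩
  rw [← w₂]
  exact hs

lemma hasRHLP_boundary_zero [KanComplex Y] (hf : Function.Surjective (mapπ₀ f)) :
    HasRHLP ∂Δ[0].ι f := by
  intro g h _
  obtain ⟨x, hx⟩ := hf (π₀.mk (yonedaEquiv h))
  induction x with | mk x
  obtain ⟨l, rfl⟩ := yonedaEquiv.surjective x
  exact ⟨l, boundary.hom_ext₀, (π₀_mk_eq_iff (l ≫ f) h _).1 hx⟩

lemma surjective_mapπ₀_of_hasRHLP (hf : HasRHLP ∂Δ[0].ι f) [KanComplex Y] :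
    Function.Surjective (mapπ₀ f) := by
  intro y
  induction y with | mk y
  obtain ⟨h, rfl⟩ := yonedaEquiv.surjective y
  obtain ⟨l, -, H⟩ := hf ((Subcomplex.eqToIso boundary_zero).hom ≫ Subcomplex.isInitialBot.to X) h
    boundary.hom_ext₀
  exact ⟨π₀.mk (yonedaEquiv l), (π₀_mk_eq_iff (l ≫ f) h _).2 H⟩

lemma surjective_mapHomotopySet_of_hasRHLP [KanComplex Y] (hf : HasRHLP ∂Δ[n].ι f)
    (x : X _⦋0⦌) : Function.Surjective (mapHomotopySet n f x) := by
  rw [surjective_mapHomotopySet_iff]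
  intro t
  obtain ⟨l, hl, H⟩ := hf (const x) t.map (by rw [t.boundary_ι_map, const_comp])
  rw [t.boundary_ι_map] at H
  exact ⟨.ofMap l hl, H⟩

lemma reflectsPtHomotopy_of_hasRHLP [KanComplex Y] (hf : HasRHLP ∂Δ[n + 1].ι f) :
    ReflectsPtHomotopy f n := by
  rintro x s t ⟨H, hH₀, hH₁, hH⟩
  have hs := s.boundary_ι_map
  have ht := t.boundary_ι_map
  obtain ⟨g, hg⟩ := boundary.exists_desc_of_const x
    (Fin.cons t.map (Fin.cons s.map (fun _ ↦ const x)) : Fin (n + 2) → (Δ[n] ⟶ X)) (fun j ↦ by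
      obtain rfl | ⟨j, rfl⟩ := j.eq_zero_or_eq_succ
      · exact ht
      · obtain rfl | ⟨j, rfl⟩ := j.eq_zero_or_eq_succ
        · exact hs
        · rfl)
  obtain ⟨G, hG⟩ := boundary.exists_desc_whiskerRight_of_const (f.app _ x)
    (Fin.cons H (Fin.cons (fst _ _ ≫ s.map ≫ f) (fun _ ↦ const (f.app _ x))) :
      Fin (n + 2) → (Δ[n] ⊗ Δ[1] ⟶ Y)) (fun j ↦ by
      obtain rfl | ⟨j, rfl⟩ := j.eq_zero_or_eq_succ
      · exact hH
      · obtain rfl | ⟨j, rfl⟩ := j.eq_zero_or_eq_succ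
        · change ∂Δ[n].ι ▷ _ ≫ fst _ _ ≫ s.map ≫ f = _
          rw [whiskerRight_fst_assoc, reassoc_of% hs, const_comp]
          rfl
        · rfl)
  -- At time 0 the faces are `s.map ≫ f` twice, then constants: the boundary of a degenerate
  -- simplex. Homotopy extension from it fills the other end `g ≫ f`.
  have e₀ : ∂Δ[n + 1].ι ≫ stdSimplex.σ 0 ≫ s.map ≫ f = ι₀ ≫ G := boundary.hom_ext fun j ↦ by
    rw [← ι₀_comp_assoc, hG, boundary.ι_ι_assoc]
    obtain rfl | ⟨j, rfl⟩ := j.eq_zero_or_eq_succ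
    · refine Eq.trans ?_ hH₀.symm
      exact CosimplicialObject.δ_comp_σ_self_assoc stdSimplex (i := (0 : Fin (n + 1))) _
    · obtain rfl | ⟨j, rfl⟩ := j.eq_zero_or_eq_succ
      · exact CosimplicialObject.δ_comp_σ_succ_assoc stdSimplex (i := (0 : Fin (n + 1))) _
      · obtain _ | n := n
        · exact j.elim0
        · have := CosimplicialObject.δ_comp_σ_of_gt stdSimplex.{u} (i := j.succ)
            (j := (0 : Fin (n + 1))) (by simp)
          rw [Fin.castSucc_zero] at this
          rw [reassoc_of% this, ← boundary.ι_ι, Category.assoc, reassoc_of% hs, const_comp]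
          rfl
  have e₁ : g ≫ f = ι₁ ≫ G := boundary.hom_ext fun j ↦ by
    rw [← ι₁_comp_assoc, hG, ← Category.assoc, hg]
    obtain rfl | ⟨j, rfl⟩ := j.eq_zero_or_eq_succ
    · exact hH₁.symm
    · obtain rfl | ⟨j, rfl⟩ := j.eq_zero_or_eq_succ
      · rfl
      · exact const_comp _ _
  obtain ⟨h, K, -, hK₁, hK⟩ := HomotopicOver.exists_of_ι₀ _ G _ e₀
  -- Only the filler `l` of `g` is needed; the homotopy in `Y` is discarded.
  obtain ⟨l, hl, -⟩ := hf g h (by rw [e₁, ← hK, ι₁_comp_assoc, hK₁])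
  have hδ (j : Fin (n + 2)) : stdSimplex.δ j ≫ l = boundary.ι j ≫ g := by
    rw [← hl, boundary.ι_ι_assoc]
  have h₀ : stdSimplex.δ 0 ≫ l = t.map := (hδ 0).trans (hg 0)
  have h₁ : stdSimplex.δ 1 ≫ l = s.map := (hδ 1).trans (hg 1)
  rw [← h₀, ← h₁]
  exact homotopicOver_δ_one_δ_zero l (by rw [h₀, ht])
    (fun j ↦ (hδ j.succ.succ).trans (hg j.succ.succ))

end SSet

theorem proposition4p1 {X Y : SSet.{u}} [SSet.KanComplex X] [SSet.KanComplex Y] (f : X ⟶ Y) :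
    SSet.IsKanWeakEquiv f ↔ ∀ n : ℕ, SSet.HasRHLP (SSet.boundary.{u} n).ι f := by
  constructor
  · rintro ⟨⟨h₀, h₀'⟩, h⟩ n
    obtain _ | n := n
    · exact SSet.hasRHLP_boundary_zero h₀'
    · refine SSet.hasRHLP_boundary_succ ?_ (fun x ↦ (h (n + 1) (by lia) x).2)
      obtain _ | n := n
      · exact SSet.injective_mapπ₀_iff.1 h₀
      · exact (SSet.injective_mapHomotopySet_iff _).1 (fun x ↦ (h (n + 1) (by lia) x).1)
  · intro h
    refine ⟨⟨?_, SSet.surjective_mapπ₀_of_hasRHLP (h 0)⟩, fun n hn x ↦ ⟨?_, ?_⟩⟩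
    · exact SSet.injective_mapπ₀_iff.2 (SSet.reflectsPtHomotopy_of_hasRHLP (h 1))
    · exact (SSet.injective_mapHomotopySet_iff n).2 (SSet.reflectsPtHomotopy_of_hasRHLP (h _)) x
    · exact SSet.surjective_mapHomotopySet_of_hasRHLP (h n) x
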